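/- Let $\lambda>0$, $r>0$ and $\lambda_r=\lambda/(\pi r^2)$. For a finite set $P\subset\mathbb R^2$ let $\mathrm{BadPairs}(P)=\{\{x,y\}: x,y\in P,\ x\ne y,\ \|x-y\|<2r\}$ and $\mathrm{BadPoints}(P)=\bigcup\mathrm{BadPairs}(P)$. Consider the following algorithm (partial rejection sampling for hard disks). 1. Let $P$ be a sample from the Poisson point process of intensity $\lambda_r$ on $[0,1]^2$. 2. While $B:=\mathrm{BadPoints}(P)\neq\emptyset$: let $S=(B+D_{2r}(\mathbf 0))\cap[0,1]^2$, where $D_{2r}(\mathbf 0)$ is the open disk of radius $2r$ centred at the origin; draw, with fresh randomness, a sample $P^S$ from the Poisson point process of intensity $\lambda_r$ on $S$; replace $P$ by $(P\setminus B)\cup P^S$. 3. Return $P$. Then the algorithm halts with positive probability and, conditional on halting, its output is distributed exactly according to the hard disks distribution, that is, the law of the Poisson point process of intensity $\lambda_r$ on $[0,1]^2$ conditioned on the event (of positive probability) that no two distinct points are at Euclidean distance less than $2r$. -/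

import Mathlib

open MeasureTheory ProbabilityTheory Set
open scoped ENNReal NNReal Pointwise Nat

namespace HardDisks

/-- The Euclidean plane. -/
abbrev Plane := EuclideanSpace ℝ (Fin 2)

/-- The unit square `[0,1]²`. -/
def unitSquare : Set Plane := {x | ∀ i, x i ∈ Icc (0 : ℝ) 1}

/-- A point configuration: a finite subset of the plane. -/
@[ext] structure Config where
  /-- the set of points -/
  pts : Set Plane
  finite : pts.Finite

/-- The number of points of `P` in the region `A`. -/
noncomputable def Config.count (A : Set Plane) (P : Config) : ℕ := (P.pts ∩ A).ncard

/-- The standard σ-algebra of point process theory: it is generated by the counting maps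
`P ↦ #(P ∩ A)`, with `A` a Borel set. -/
noncomputable instance : MeasurableSpace Config :=
  ⨆ A : {A : Set Plane // MeasurableSet A}, MeasurableSpace.comap (Config.count A.1) ⊤

instance : Nonempty Config := ⟨⟨∅, finite_empty⟩⟩

/-! ### Measurability of maps to and from configurations -/

lemma measurable_count {A : Set Plane} (hA : MeasurableSet A) : Measurable (Config.count A) :=
  Measurable.of_comap_le
    (le_iSup (fun A : {A : Set Plane // MeasurableSet A} =>
      MeasurableSpace.comap (Config.count A.1) ⊤) ⟨A, hA⟩)

lemma measurableSet_hit {A : Set Plane} (hA : MeasurableSet A) :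
    MeasurableSet {P : Config | ∃ p ∈ P.pts, p ∈ A} := by
  have : {P : Config | ∃ p ∈ P.pts, p ∈ A} = Config.count A ⁻¹' {0}ᶜ := by
    ext P
    have hf : (P.pts ∩ A).Finite := P.finite.inter_of_left A
    simp only [mem_ofPred_eq, mem_preimage, mem_compl_iff, mem_singleton_iff, Config.count,
      ncard_eq_zero hf, ← nonempty_iff_ne_empty]
    rfl
  rw [this]
  exact measurable_count hA (MeasurableSet.of_discrete)

/-- A region contains at least `n` points iff there are `n` disjoint basic open sets
in each of which it contains a point. -/
lemma le_count_iff (A : Set Plane) (P : Config) (n : ℕ) :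
    n ≤ P.count A ↔ ∃ V : Fin n → TopologicalSpace.countableBasis Plane,
      (∀ i j, i ≠ j → Disjoint (V i : Set Plane) (V j)) ∧
        ∀ i, ∃ p ∈ P.pts, p ∈ A ∩ (V i : Set Plane) := by
  have hf : (P.pts ∩ A).Finite := P.finite.inter_of_left A
  constructor
  · intro h
    obtain ⟨t, ht, htn⟩ := exists_subset_card_eq h
    have htf : t.Finite := hf.subset ht
    obtain ⟨U, hU, hdis⟩ := htf.t2_separation
    have hb : ∀ x, ∃ v ∈ TopologicalSpace.countableBasis Plane, x ∈ v ∧ v ⊆ U x := fun x =>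
      (TopologicalSpace.isBasis_countableBasis Plane).exists_subset_of_mem_open (hU x).1 (hU x).2
    choose v hv hxv hvU using hb
    have : Finite t := htf
    let e : t ≃ Fin n := Finite.equivFinOfCardEq htn
    refine ⟨fun i => ⟨v (e.symm i), hv _⟩, fun i j hij => ?_, fun i => ?_⟩
    · refine (hdis (e.symm i).2 (e.symm j).2 ?_).mono (hvU _) (hvU _)
      intro h
      exact hij (e.symm.injective (Subtype.ext h))
    · exact ⟨e.symm i, (ht (e.symm i).2).1, (ht (e.symm i).2).2, hxv _⟩
  · rintro ⟨V, hV, h⟩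
    choose p hp hpA using h
    have hinj : Function.Injective p := by
      intro i j hij
      by_contra hne
      exact Set.disjoint_left.1 (hV i j hne) (hpA i).2 (hij ▸ (hpA j).2)
    calc n = (range p).ncard := by
            rw [← image_univ, ncard_image_of_injective _ hinj, ncard_univ, Nat.card_fin]
      _ ≤ _ := ncard_le_ncard (by rintro _ ⟨i, rfl⟩; exact ⟨hp i, (hpA i).1⟩) hf

lemma measurable_of_hit {Ω : Type*} [MeasurableSpace Ω] {f : Ω → Config}
    (h : ∀ A : Set Plane, MeasurableSet A → MeasurableSet {ω | ∃ p ∈ (f ω).pts, p ∈ A}) :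
    Measurable f := by
  refine Measurable.of_le_map (iSup_le fun A => ?_)
  rw [← measurable_iff_comap_le]
  have key : Measurable fun ω => Config.count A.1 (f ω) := by
    refine measurable_of_Ici fun n => ?_
    have : (fun ω => Config.count A.1 (f ω)) ⁻¹' Ici n =
        ⋃ V : Fin n → TopologicalSpace.countableBasis Plane,
          ⋃ (_ : ∀ i j, i ≠ j → Disjoint (V i : Set Plane) (V j)),
            ⋂ i, {ω | ∃ p ∈ (f ω).pts, p ∈ A.1 ∩ (V i : Set Plane)} := by
      ext ω
      simp only [mem_preimage, mem_Ici, le_count_iff, mem_iUnion, mem_iInter, mem_ofPred_eq,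
        exists_prop]
    rw [this]
    have hc : Countable (TopologicalSpace.countableBasis Plane) :=
      (TopologicalSpace.countable_countableBasis Plane).to_subtype
    refine MeasurableSet.iUnion fun V => MeasurableSet.iUnion fun _ =>
      MeasurableSet.iInter fun i => h _ (A.2.inter ?_)
    exact (TopologicalSpace.isOpen_of_mem_countableBasis (V i).2).measurableSet
  intro s hs
  obtain ⟨t, -, rfl⟩ := hs
  exact key MeasurableSet.of_discrete

/-- An open relation between two points is a countable union of boxes. -/
lemma exists_boxes {X Y : Type*} [TopologicalSpace X] [TopologicalSpace Y]
    [SecondCountableTopology X] [SecondCountableTopology Y] {W : Set (X × Y)} (hW : IsOpen W) :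
    ∃ (U : ℕ → Set X) (V : ℕ → Set Y), (∀ n, IsOpen (U n)) ∧ (∀ n, IsOpen (V n)) ∧
      W = ⋃ n, U n ×ˢ V n := by
  have hB := (TopologicalSpace.isBasis_countableBasis X).prod
    (TopologicalSpace.isBasis_countableBasis Y)
  obtain ⟨S, hS, rfl⟩ := hB.open_eq_sUnion hW
  have hSc : S.Countable := by
    refine Countable.mono hS ?_
    exact (TopologicalSpace.countable_countableBasis X).image2
      (TopologicalSpace.countable_countableBasis Y) _
  rcases S.eq_empty_or_nonempty with rfl | hne
  · exact ⟨fun _ => ∅, fun _ => ∅, by simp, by simp, by simp⟩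
  obtain ⟨g, rfl⟩ := hSc.exists_eq_range hne
  have : ∀ n, ∃ U V, IsOpen U ∧ IsOpen V ∧ U ×ˢ V = g n := fun n => by
    obtain ⟨U, hU, V, hV, h⟩ := hS (mem_range_self n)
    exact ⟨U, V, TopologicalSpace.isOpen_of_mem_countableBasis hU,
      TopologicalSpace.isOpen_of_mem_countableBasis hV, h⟩
  choose U V hU hV h using this
  exact ⟨U, V, hU, hV, by simp [h, sUnion_range]⟩

/-! ### Bad pairs, bad points and the resampling set -/

/-- The set of all `{x, y}` with `x, y ∈ P`, `x ≠ y` and `‖x - y‖ < 2r`. -/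
def badPairs (r : ℝ) (P : Config) : Set (Set Plane) :=
  {e | ∃ x ∈ P.pts, ∃ y ∈ P.pts, x ≠ y ∧ ‖x - y‖ < 2 * r ∧ e = {x, y}}

/-- The set of points that belong to a bad pair. -/
def badPoints (r : ℝ) (P : Config) : Set Plane := ⋃₀ badPairs r P

lemma mem_badPoints {r : ℝ} {P : Config} {x : Plane} :
    x ∈ badPoints r P ↔ x ∈ P.pts ∧ ∃ y ∈ P.pts, x ≠ y ∧ ‖x - y‖ < 2 * r := by
  constructor
  · rintro ⟨e, ⟨a, ha, b, hb, hab, hn, rfl⟩, hx⟩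
    rcases hx with rfl | hx
    · exact ⟨ha, b, hb, hab, hn⟩
    · rw [mem_singleton_iff] at hx
      subst hx
      exact ⟨hb, a, ha, hab.symm, by rwa [norm_sub_rev]⟩
  · rintro ⟨hx, y, hy, hxy, hn⟩
    exact ⟨{x, y}, ⟨x, hx, y, hy, hxy, hn, rfl⟩, by simp⟩

lemma badPoints_subset (r : ℝ) (P : Config) : badPoints r P ⊆ P.pts :=
  fun _ hx => (mem_badPoints.1 hx).1

/-- The part `(B + D_{2r}(0)) ∩ [0,1]²` of the Minkowski sum of the set `B` of bad points
with an open disk of radius `2r` that lies in the unit square. -/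
def resamplingSet (r : ℝ) (P : Config) : Set Plane :=
  (badPoints r P + Metric.ball (0 : Plane) (2 * r)) ∩ unitSquare

/-- The update `P ← (P \ B) ∪ Q`, with `B` the set of bad points of `P`. -/
def update (r : ℝ) (P Q : Config) : Config where
  pts := (P.pts \ badPoints r P) ∪ Q.pts
  finite := P.finite.sdiff.union Q.finite

/-! ### The Poisson point process -/

/-- The configuration `{x₁, …, xₙ}`. -/
def ofTuple {n : ℕ} (x : Fin n → Plane) : Config := ⟨range x, finite_range x⟩

/-- The law of the Poisson point process of intensity `c` on a region `S` of finite area `|S|`: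
`exp (-c|S|) ∑ₙ (cⁿ / n!) ∫_{Sⁿ} 𝟙[{x₁, …, xₙ} ∈ ·] dx₁ ⋯ dxₙ`, i.e. the number of points is
Poisson with mean `c|S|` and, given their number, the points are i.i.d. uniform on `S`. -/
noncomputable def poissonProcess (c : ℝ≥0) (S : Set Plane) : Measure Config :=
  ENNReal.ofReal (Real.exp (-(c * volume.real S))) •
    Measure.sum fun n : ℕ => (n ! : ℝ≥0∞)⁻¹ •
      (Measure.pi fun _ : Fin n => c • (volume : Measure Plane).restrict S).map ofTuple

lemma measurable_ofTuple (n : ℕ) : Measurable (ofTuple : (Fin n → Plane) → Config) := by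
  refine measurable_of_hit fun A hA => ?_
  have : {x : Fin n → Plane | ∃ p ∈ (ofTuple x).pts, p ∈ A} = ⋃ i, (fun x => x i) ⁻¹' A := by
    ext x; simp [ofTuple]
  rw [this]
  exact MeasurableSet.iUnion fun i => measurable_pi_apply i hA

/-- The probability that a region `A` is void of points is `exp (-c|S ∩ A|)`. -/
lemma poissonProcess_void (c : ℝ≥0) {S A : Set Plane} (hS : volume S ≠ ∞)
    (hA : MeasurableSet A) :
    poissonProcess c S {P | ¬ ∃ p ∈ P.pts, p ∈ A} =
      ENNReal.ofReal (Real.exp (-(c * volume.real (S ∩ A)))) := by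
  have hm : MeasurableSet {P : Config | ¬ ∃ p ∈ P.pts, p ∈ A} := (measurableSet_hit hA).compl
  have hfin : IsFiniteMeasure ((volume : Measure Plane).restrict S) :=
    ⟨by simpa using hS.lt_top⟩
  have hfin' : volume (S \ A) ≠ ∞ := measure_ne_top_of_subset sdiff_subset hS
  have hterm : ∀ n : ℕ, ((n ! : ℝ≥0∞)⁻¹ •
      (Measure.pi fun _ : Fin n => c • (volume : Measure Plane).restrict S).map ofTuple)
        {P | ¬ ∃ p ∈ P.pts, p ∈ A} =
      ENNReal.ofReal ((c * volume.real (S \ A)) ^ n / n !) := by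
    intro n
    have hpre : (ofTuple : (Fin n → Plane) → Config) ⁻¹' {P | ¬ ∃ p ∈ P.pts, p ∈ A} =
        univ.pi fun _ => Aᶜ := by
      ext x; simp [ofTuple]
    rw [Measure.smul_apply, Measure.map_apply (measurable_ofTuple n) hm, hpre, Measure.pi_pi,
      Finset.prod_const, Finset.card_univ, Fintype.card_fin, Measure.smul_apply,
      Measure.restrict_apply hA.compl, inter_comm, ← sdiff_eq, smul_eq_mul,
      ENNReal.ofReal_div_of_pos (by positivity), ENNReal.ofReal_pow (by positivity),
      ENNReal.ofReal_mul (by positivity), ofReal_measureReal hfin', ENNReal.ofReal_coe_nnreal,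
      ENNReal.ofReal_natCast, mul_comm, div_eq_mul_inv, ENNReal.smul_def, smul_eq_mul]
  rw [poissonProcess, Measure.smul_apply, Measure.sum_apply _ hm]
  simp_rw [hterm]
  rw [← ENNReal.ofReal_tsum_of_nonneg (fun n => by positivity)
      (Real.summable_pow_div_factorial _), smul_eq_mul,
    ← ENNReal.ofReal_mul (by positivity)]
  congr 1
  have hexp : ∑' n : ℕ, (c * volume.real (S \ A)) ^ n / (n ! : ℝ) =
      Real.exp (c * volume.real (S \ A)) := by
    rw [Real.exp_eq_exp_ℝ, NormedSpace.exp_eq_tsum_div]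
  rw [hexp, ← Real.exp_add]
  congr 1
  have := measureReal_inter_add_sdiff (μ := volume) (s := S) hA hS
  rw [← this]
  ring

lemma isProbabilityMeasure_poissonProcess (c : ℝ≥0) {S : Set Plane} (hS : volume S ≠ ∞) :
    IsProbabilityMeasure (poissonProcess c S) :=
  ⟨by simpa using poissonProcess_void c hS MeasurableSet.empty⟩

lemma isCompact_unitSquare : IsCompact unitSquare := by
  have : unitSquare = (EuclideanSpace.equiv (Fin 2) ℝ).toHomeomorph ⁻¹'
      (univ.pi fun _ => Icc (0 : ℝ) 1) := by
    ext x
    simp only [unitSquare, mem_ofPred_eq, mem_preimage, mem_univ_pi]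
    rfl
  rw [this, Homeomorph.isCompact_preimage]
  exact isCompact_univ_pi fun _ => isCompact_Icc

lemma measurableSet_unitSquare : MeasurableSet unitSquare :=
  isCompact_unitSquare.isClosed.measurableSet

lemma volume_unitSquare_ne_top : volume unitSquare ≠ ∞ := isCompact_unitSquare.measure_ne_top

lemma volume_resamplingSet_ne_top (r : ℝ) (P : Config) : volume (resamplingSet r P) ≠ ∞ :=
  measure_ne_top_of_subset inter_subset_right volume_unitSquare_ne_top

lemma mem_resamplingSet {r : ℝ} {P : Config} {z : Plane} :
    z ∈ resamplingSet r P ↔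
      (∃ x ∈ P.pts, ∃ y ∈ P.pts, x ≠ y ∧ ‖x - y‖ < 2 * r ∧ ‖z - x‖ < 2 * r) ∧ z ∈ unitSquare := by
  rw [resamplingSet, mem_inter_iff, mem_add]
  refine and_congr_left fun _ => ?_
  constructor
  · rintro ⟨x, hx, d, hd, rfl⟩
    obtain ⟨hxP, y, hy, hxy, hn⟩ := mem_badPoints.1 hx
    exact ⟨x, hxP, y, hy, hxy, hn, by simpa using hd⟩
  · rintro ⟨x, hx, y, hy, hxy, hn, hz⟩
    exact ⟨x, mem_badPoints.2 ⟨hx, y, hy, hxy, hn⟩, z - x, by simpa using hz, by abel⟩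

/-! ### Measurability of the loop body -/

lemma measurableSet_mem_resamplingSet (r : ℝ) :
    MeasurableSet {q : Config × Plane | q.2 ∈ resamplingSet r q.1} := by
  let W : Set (Plane × (Plane × Plane)) :=
    {w | w.1 ≠ w.2.1 ∧ ‖w.1 - w.2.1‖ < 2 * r ∧ ‖w.2.2 - w.1‖ < 2 * r}
  have hW : IsOpen W := by
    have h1 : IsOpen {w : Plane × (Plane × Plane) | w.1 ≠ w.2.1} :=
      isOpen_ne_fun (by fun_prop) (by fun_prop)
    have h2 : IsOpen {w : Plane × (Plane × Plane) | ‖w.1 - w.2.1‖ < 2 * r} :=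
      isOpen_lt (by fun_prop) (by fun_prop)
    have h3 : IsOpen {w : Plane × (Plane × Plane) | ‖w.2.2 - w.1‖ < 2 * r} :=
      isOpen_lt (by fun_prop) (by fun_prop)
    exact h1.inter (h2.inter h3)
  obtain ⟨U, V, hU, hV, hUV⟩ := exists_boxes hW
  choose G H hG hH hGH using fun n => exists_boxes (hV n)
  have : {q : Config × Plane | q.2 ∈ resamplingSet r q.1} =
      (⋃ n, ⋃ m, ((Prod.fst ⁻¹' {P : Config | ∃ p ∈ P.pts, p ∈ U n}) ∩
        (Prod.fst ⁻¹' {P : Config | ∃ p ∈ P.pts, p ∈ G n m})) ∩ Prod.snd ⁻¹' H n m) ∩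
      Prod.snd ⁻¹' unitSquare := by
    ext ⟨P, z⟩
    simp only [mem_ofPred_eq, mem_resamplingSet, mem_inter_iff, mem_preimage, mem_iUnion]
    refine and_congr_left fun _ => ?_
    constructor
    · rintro ⟨x, hx, y, hy, hxy, h1, h2⟩
      have hw : (x, y, z) ∈ W := ⟨hxy, h1, h2⟩
      rw [hUV] at hw
      obtain ⟨n, hn⟩ := mem_iUnion.1 hw
      have hn2 : (y, z) ∈ V n := hn.2
      rw [hGH n] at hn2
      obtain ⟨m, hm⟩ := mem_iUnion.1 hn2
      exact ⟨n, m, ⟨⟨x, hx, hn.1⟩, ⟨y, hy, hm.1⟩⟩, hm.2⟩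
    · rintro ⟨n, m, ⟨⟨x, hx, hxU⟩, ⟨y, hy, hyG⟩⟩, hz⟩
      have h2 : (y, z) ∈ V n := by
        rw [hGH n]; exact mem_iUnion.2 ⟨m, hyG, hz⟩
      have hw : (x, y, z) ∈ W := by
        rw [hUV]; exact mem_iUnion.2 ⟨n, hxU, h2⟩
      exact ⟨x, hx, y, hy, hw.1, hw.2.1, hw.2.2⟩
  rw [this]
  refine (MeasurableSet.iUnion fun n => MeasurableSet.iUnion fun m => ?_).inter
    (measurable_snd measurableSet_unitSquare)
  exact ((measurable_fst (measurableSet_hit (hU n).measurableSet)).inter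
    (measurable_fst (measurableSet_hit (hG n m).measurableSet))).inter
      (measurable_snd (hH n m).measurableSet)

/-- The event that some point of `A` and some point of `A'` are at distance less than `2r`. -/
lemma measurableSet_exists_near (r : ℝ) {A A' : Set Plane} (hA : MeasurableSet A)
    (hA' : MeasurableSet A') :
    MeasurableSet {P : Config | ∃ x ∈ P.pts, ∃ y ∈ P.pts, x ∈ A ∧ y ∈ A' ∧ x ≠ y ∧
      ‖x - y‖ < 2 * r} := by
  let W : Set (Plane × Plane) := {w | w.1 ≠ w.2 ∧ ‖w.1 - w.2‖ < 2 * r}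
  have hW : IsOpen W := by
    have h1 : IsOpen {w : Plane × Plane | w.1 ≠ w.2} :=
      isOpen_ne_fun (by fun_prop) (by fun_prop)
    have h2 : IsOpen {w : Plane × Plane | ‖w.1 - w.2‖ < 2 * r} :=
      isOpen_lt (by fun_prop) (by fun_prop)
    exact h1.inter h2
  obtain ⟨U, V, hU, hV, hUV⟩ := exists_boxes hW
  have : {P : Config | ∃ x ∈ P.pts, ∃ y ∈ P.pts, x ∈ A ∧ y ∈ A' ∧ x ≠ y ∧ ‖x - y‖ < 2 * r} =
      ⋃ n, {P : Config | ∃ p ∈ P.pts, p ∈ A ∩ U n} ∩ {P : Config | ∃ p ∈ P.pts, p ∈ A' ∩ V n} := by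
    ext P
    simp only [mem_ofPred_eq, mem_iUnion, mem_inter_iff]
    constructor
    · rintro ⟨x, hx, y, hy, hxA, hyA, hxy, h⟩
      have hw : (x, y) ∈ W := ⟨hxy, h⟩
      rw [hUV] at hw
      obtain ⟨n, hn⟩ := mem_iUnion.1 hw
      exact ⟨n, ⟨x, hx, hxA, hn.1⟩, ⟨y, hy, hyA, hn.2⟩⟩
    · rintro ⟨n, ⟨x, hx, hxA, hxU⟩, ⟨y, hy, hyA, hyV⟩⟩
      have hw : (x, y) ∈ W := by
        rw [hUV]; exact mem_iUnion.2 ⟨n, hxU, hyV⟩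
      exact ⟨x, hx, y, hy, hxA, hyA, hw.1, hw.2⟩
  rw [this]
  exact MeasurableSet.iUnion fun n => (measurableSet_hit (hA.inter (hU n).measurableSet)).inter
    (measurableSet_hit (hA'.inter (hV n).measurableSet))

lemma measurableSet_badPoints_eq_empty (r : ℝ) :
    MeasurableSet {P : Config | badPoints r P = ∅} := by
  have : {P : Config | badPoints r P = ∅} = {P : Config | ∃ x ∈ P.pts, ∃ y ∈ P.pts,
      x ∈ univ ∧ y ∈ univ ∧ x ≠ y ∧ ‖x - y‖ < 2 * r}ᶜ := by
    ext P
    simp only [mem_ofPred_eq, mem_compl_iff, eq_empty_iff_forall_notMem, mem_badPoints, mem_univ,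
      true_and]
    push Not
    exact ⟨fun h x hx => h x hx, fun h x hx => h x hx⟩
  rw [this]
  exact (measurableSet_exists_near r MeasurableSet.univ MeasurableSet.univ).compl

/-- The event that some point in `A` is not a bad point. -/
lemma measurableSet_hit_good (r : ℝ) {A : Set Plane} (hA : MeasurableSet A) :
    MeasurableSet {P : Config | ∃ p ∈ P.pts \ badPoints r P, p ∈ A} := by
  have hc : Countable (TopologicalSpace.countableBasis Plane) :=
    (TopologicalSpace.countable_countableBasis Plane).to_subtype
  have hm : ∀ U : TopologicalSpace.countableBasis Plane, MeasurableSet (U : Set Plane) :=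
    fun U => (TopologicalSpace.isOpen_of_mem_countableBasis U.2).measurableSet
  have : {P : Config | ∃ p ∈ P.pts \ badPoints r P, p ∈ A} =
      ⋃ U : TopologicalSpace.countableBasis Plane, (Config.count U ⁻¹' {1} ∩
        {P : Config | ∃ p ∈ P.pts, p ∈ A ∩ (U : Set Plane)}) ∩
        {P : Config | ∃ x ∈ P.pts, ∃ y ∈ P.pts, x ∈ (U : Set Plane) ∧ y ∈ univ ∧ x ≠ y ∧
          ‖x - y‖ < 2 * r}ᶜ := by
    ext P
    simp only [mem_ofPred_eq, mem_iUnion, mem_inter_iff, mem_preimage, mem_singleton_iff,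
      mem_compl_iff]
    constructor
    · rintro ⟨p, ⟨hp, hgood⟩, hpA⟩
      have hopen : IsOpen (P.pts \ {p})ᶜ := (P.finite.sdiff).isClosed.isOpen_compl
      obtain ⟨U, hU, hpU, hsub⟩ :=
        (TopologicalSpace.isBasis_countableBasis Plane).exists_subset_of_mem_open
          (a := p) (by simp) hopen
      have huniq : ∀ x ∈ P.pts, x ∈ U → x = p := by
        intro x hx hxU
        by_contra hne
        exact hsub hxU ⟨hx, hne⟩
      refine ⟨⟨U, hU⟩, ⟨?_, p, hp, hpA, hpU⟩, ?_⟩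
      · rw [Config.count, ncard_eq_one]
        refine ⟨p, Subset.antisymm (fun x hx => huniq x hx.1 hx.2) ?_⟩
        rintro _ rfl
        exact ⟨hp, hpU⟩
      · rintro ⟨x, hx, y, hy, hxU, -, hxy, hn⟩
        obtain rfl := huniq x hx hxU
        exact hgood (mem_badPoints.2 ⟨hx, y, hy, hxy, hn⟩)
    · rintro ⟨U, ⟨-, p, hp, hpA, hpU⟩, hno⟩
      refine ⟨p, ⟨hp, fun hbad => hno ?_⟩, hpA⟩
      obtain ⟨-, y, hy, hpy, hn⟩ := mem_badPoints.1 hbad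
      exact ⟨p, hp, y, hy, hpU, mem_univ y, hpy, hn⟩
  rw [this]
  exact MeasurableSet.iUnion fun U =>
    ((measurable_count (hm U) MeasurableSet.of_discrete).inter
      (measurableSet_hit (hA.inter (hm U)))).inter
      (measurableSet_exists_near r (hm U) MeasurableSet.univ).compl

lemma measurable_update (r : ℝ) :
    Measurable fun q : Config × Config => update r q.1 q.2 := by
  refine measurable_of_hit fun A hA => ?_
  have : {q : Config × Config | ∃ p ∈ (update r q.1 q.2).pts, p ∈ A} =
      Prod.fst ⁻¹' {P : Config | ∃ p ∈ P.pts \ badPoints r P, p ∈ A} ∪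
        Prod.snd ⁻¹' {P : Config | ∃ p ∈ P.pts, p ∈ A} := by
    ext ⟨P, Q⟩
    simp only [update, mem_ofPred_eq, mem_union, mem_preimage, or_and_right, exists_or]
  rw [this]
  exact (measurable_fst (measurableSet_hit_good r hA)).union (measurable_snd (measurableSet_hit hA))

lemma measurable_poissonProcess_resamplingSet (c : ℝ≥0) (r : ℝ) :
    Measurable fun P : Config => poissonProcess c (resamplingSet r P) := by
  have hR := measurableSet_mem_resamplingSet r
  refine Measure.measurable_of_measurable_coe _ fun E hE => ?_
  simp only [poissonProcess, Measure.smul_apply, Measure.sum_apply _ hE, smul_eq_mul]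
  refine Measurable.mul ?_ (Measurable.tsum fun n => Measurable.const_mul ?_ _)
  · have hv : Measurable fun P : Config => volume (resamplingSet r P) :=
      measurable_measure_prodMk_left hR
    have hv' : Measurable fun P : Config => volume.real (resamplingSet r P) := hv.ennreal_toReal
    fun_prop
  · have heq : ∀ P : Config,
        ((Measure.pi fun _ : Fin n => c • (volume : Measure Plane).restrict
          (resamplingSet r P)).map ofTuple) E =
        (Measure.pi fun _ : Fin n => c • (volume : Measure Plane)) (Prod.mk P ⁻¹'
          {q : Config × (Fin n → Plane) | q.2 ∈ ofTuple ⁻¹' E ∧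
            ∀ i, q.2 i ∈ resamplingSet r q.1}) := by
      intro P
      have hE' := measurable_ofTuple n hE
      have h1 : (fun _ : Fin n => c • (volume : Measure Plane).restrict (resamplingSet r P)) =
          fun _ => (c • (volume : Measure Plane)).restrict (resamplingSet r P) := by
        funext _
        exact (Measure.restrict_smul c volume _).symm
      rw [Measure.map_apply (measurable_ofTuple n) hE, h1, ← Measure.restrict_pi_pi,
        Measure.restrict_apply hE']
      congr 1
      ext x
      simp
    simp_rw [heq]
    refine measurable_measure_prodMk_left (MeasurableSet.inter ?_ ?_)
    · exact measurable_snd (measurable_ofTuple n hE)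
    · have : {q : Config × (Fin n → Plane) | ∀ i, q.2 i ∈ resamplingSet r q.1} =
          ⋂ i, (fun q : Config × (Fin n → Plane) => (q.1, q.2 i)) ⁻¹'
            {q : Config × Plane | q.2 ∈ resamplingSet r q.1} := by
        ext q; simp
      change MeasurableSet {q : Config × (Fin n → Plane) | ∀ i, q.2 i ∈ resamplingSet r q.1}
      rw [this]
      exact MeasurableSet.iInter fun i => (by fun_prop :
        Measurable fun q : Config × (Fin n → Plane) => (q.1, q.2 i)) hR

/-! ### The algorithm -/

/-- The intensity `λ / (π r²)`. -/
noncomputable def intensity (lam r : ℝ) : ℝ≥0 := (lam / (Real.pi * r ^ 2)).toNNReal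

/-- The body of the while-loop as a Markov kernel: given the current point set `P`, with bad
points `B` and resampling set `S`, sample `Q` from the Poisson point process on `S` and replace
`P` by `(P \ B) ∪ Q`. -/
noncomputable def loopBody (lam r : ℝ) : Kernel Config Config where
  toFun P := (poissonProcess (intensity lam r) (resamplingSet r P)).map (update r P)
  measurable' := by
    let κ : Kernel Config Config :=
      ⟨fun P => poissonProcess (intensity lam r) (resamplingSet r P),
        measurable_poissonProcess_resamplingSet _ r⟩
    have hκ : IsMarkovKernel κ :=
      ⟨fun P => isProbabilityMeasure_poissonProcess _ (volume_resamplingSet_ne_top r P)⟩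
    refine Measure.measurable_of_measurable_coe _ fun E hE => ?_
    have hpre := measurable_update r hE
    have : ∀ P, ((poissonProcess (intensity lam r) (resamplingSet r P)).map (update r P)) E =
        κ P (Prod.mk P ⁻¹' ((fun q : Config × Config => update r q.1 q.2) ⁻¹' E)) := fun P =>
      Measure.map_apply ((measurable_update r).comp measurable_prodMk_left) hE
    simp_rw [this]
    exact Kernel.measurable_kernel_prodMk_left hpre

instance (lam r : ℝ) : IsMarkovKernel (loopBody lam r) :=
  ⟨fun P => by
    have := isProbabilityMeasure_poissonProcess (intensity lam r) (volume_resamplingSet_ne_top r P)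
    exact Measure.isProbabilityMeasure_map
      ((measurable_update r).comp measurable_prodMk_left).aemeasurable⟩

/-- The law of the sequence `P₀, P₁, P₂, …` of point sets of a run of the algorithm: `P₀` is a
Poisson point process on the unit square, and `P_{t+1}` is obtained from `P_t` by one execution
of the loop body, with fresh randomness. (The sequence is continued after the loop has been left;
the output does not depend on this continuation.) -/
noncomputable def runLaw (lam r : ℝ) : Measure (ℕ → Config) :=
  Kernel.trajMeasure (X := fun _ => Config) (poissonProcess (intensity lam r) unitSquare)
    fun t => (loopBody lam r).comap (fun h => h ⟨t, Finset.mem_Iic.2 le_rfl⟩)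
      (measurable_pi_apply _)

/-- The event that the algorithm halts: the condition of the while-loop fails at some time. -/
def halts (r : ℝ) : Set (ℕ → Config) := {P | ∃ t, badPoints r (P t) = ∅}

/-- The output: the point set at the first time when it has no bad points
(an irrelevant value if there is no such time). -/
noncomputable def output (r : ℝ) (P : ℕ → Config) : Config :=
  P (sInf {t | badPoints r (P t) = ∅})

/-- The hard disks distribution: the law of the Poisson point process of intensity `λ / (π r²)`
on the unit square, conditioned on the event that no two points are closer than `2r`. -/
noncomputable def hardDisks (lam r : ℝ) : Measure Config :=
  (poissonProcess (intensity lam r) unitSquare)[|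
    {P : Config | ∀ x ∈ P.pts, ∀ y ∈ P.pts, x ≠ y → 2 * r ≤ ‖x - y‖}]

end HardDisks

/-! Every law is written as a density against the Lebesgue–Poisson measure on configurations in the
square. The invariant is that the density of the point set after `t` loops depends on a
configuration only through its bad points (`density_congr`).

At time 0 the density is constant. For one loop, split a configuration into its bad part `A` and its
good part `C`. The Lebesgue–Poisson measure turns this into a double integral over independent `A`
and `C`, restricted to compatible pairs (`lintegral_lebesguePoisson_split`). By the invariant the
density is a function of `A` alone. Compatibility means that `A` is all bad, and that `C` is hard
and avoids the `2r`-neighbourhood of `A`. Resampling adds Poisson points `Q` exactly in that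
neighbourhood, within the square. Since `C` lives outside and `Q` inside, `C ∪ Q` recombines into
one Lebesgue–Poisson configuration `P'` (`lintegral_lebesguePoisson_split_region`). The new density
at `P'` is thus an integral over `A`, in which `P'` enters only through the condition that it has no
bad pair outside the neighbourhood of `A`. That condition depends only on the bad points of `P'`, so
the invariant survives (`bind_loopBody_withDensity`, `nextDensity_congr`).

All hard configurations have the same, empty, bad set, so on them the density at each time is a
constant, its value at the empty configuration. A hard configuration is almost surely left unchanged
by the loop body. Hence halting with output in `E` is, up to null sets, an increasing union over `t`
of the events that the point set at time `t` is hard and in `E`. Its probability is one constant,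
independent of `E`, times the Poisson mass of the hard configurations in `E`. The constant is
nonzero already because of time 0, and conditioning cancels it. -/

namespace HardDisks

/-! ### The Lebesgue–Poisson measure -/

/-- The configuration of values of a finite family of points. -/
def ofFamily {ι : Type*} [Finite ι] (x : ι → Plane) : Config := ⟨range x, finite_range x⟩

/-- The union of two configurations. -/
def Config.union (P Q : Config) : Config := ⟨P.pts ∪ Q.pts, P.finite.union Q.finite⟩

/-- The Lebesgue–Poisson measure `∑ₙ (1 / n!) ∫ 𝟙[{x₁, …, xₙ} ∈ ·] m(dx₁) ⋯ m(dxₙ)`. -/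
noncomputable def lebesguePoisson (m : Measure Plane) : Measure Config :=
  Measure.sum fun n : ℕ => (n ! : ℝ≥0∞)⁻¹ • (Measure.pi fun _ : Fin n => m).map ofTuple

lemma poissonProcess_eq_smul (c : ℝ≥0) (S : Set Plane) :
    poissonProcess c S = ENNReal.ofReal (Real.exp (-(c * volume.real S))) •
      lebesguePoisson (c • (volume : Measure Plane).restrict S) := rfl

lemma lintegral_lebesguePoisson (m : Measure Plane) {F : Config → ℝ≥0∞} (hF : Measurable F) :
    ∫⁻ P, F P ∂lebesguePoisson m =
      ∑' n : ℕ, (n ! : ℝ≥0∞)⁻¹ * ∫⁻ x, F (ofTuple x) ∂Measure.pi fun _ : Fin n => m := by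
  simp only [lebesguePoisson, lintegral_sum_measure, lintegral_smul_measure, smul_eq_mul,
    lintegral_map hF (measurable_ofTuple _)]

instance (m : Measure Plane) [SigmaFinite m] : SFinite (lebesguePoisson m) := by
  unfold lebesguePoisson
  infer_instance

lemma measurable_union : Measurable fun q : Config × Config => q.1.union q.2 := by
  refine measurable_of_hit fun A hA => ?_
  have : {q : Config × Config | ∃ p ∈ (q.1.union q.2).pts, p ∈ A} =
      Prod.fst ⁻¹' {P : Config | ∃ p ∈ P.pts, p ∈ A} ∪
        Prod.snd ⁻¹' {P : Config | ∃ p ∈ P.pts, p ∈ A} := by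
    ext ⟨P, Q⟩
    simp only [Config.union, mem_ofPred_eq, mem_union, mem_preimage, or_and_right, exists_or]
  rw [this]
  exact (measurable_fst (measurableSet_hit hA)).union (measurable_snd (measurableSet_hit hA))

lemma lintegral_pi_ofFamily {ι : Type*} [Fintype ι] (m : Measure Plane) [SigmaFinite m] {k : ℕ}
    (hk : Fintype.card ι = k) (F : Config → ℝ≥0∞) :
    ∫⁻ x, F (ofFamily x) ∂Measure.pi (fun _ : ι => m) =
      ∫⁻ y, F (ofTuple y) ∂Measure.pi (fun _ : Fin k => m) := by
  let e : Fin k ≃ ι := (Fintype.equivFinOfCardEq hk).symm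
  have h := (measurePreserving_piCongrLeft (fun _ : ι => m) e).lintegral_map_equiv
    (fun x => F (ofFamily x)) 
  rw [h]
  refine lintegral_congr fun y => ?_
  congr 1
  ext p
  simp only [ofFamily, ofTuple, mem_range]
  rw [← e.exists_congr_right]
  simp only [MeasurableEquiv.coe_piCongrLeft, Equiv.piCongrLeft_apply_apply]

lemma measurable_ofFamily (ι : Type*) [Finite ι] :
    Measurable (ofFamily : (ι → Plane) → Config) := by
  refine measurable_of_hit fun A hA => ?_
  have : {x : ι → Plane | ∃ p ∈ (ofFamily x).pts, p ∈ A} = ⋃ i, (fun x => x i) ⁻¹' A := by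
    ext x; simp [ofFamily]
  rw [this]
  exact MeasurableSet.iUnion fun i => measurable_pi_apply i hA

/-- Tonelli for the coordinates inside and outside `J`. Since configurations forget labels, only the
cardinality of `J` survives on the right. -/
lemma lintegral_pi_subset (m : Measure Plane) [SigmaFinite m] {n : ℕ} (J : Finset (Fin n))
    {G : Config × Config → ℝ≥0∞} (hG : Measurable G) :
    ∫⁻ x, G (ofFamily fun i : {i // i ∈ J} => x i, ofFamily fun i : {i // i ∉ J} => x i)
        ∂Measure.pi (fun _ : Fin n => m) =
      ∫⁻ y, ∫⁻ z, G (ofTuple y, ofTuple z) ∂Measure.pi (fun _ : Fin (n - J.card) => m)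
        ∂Measure.pi (fun _ : Fin J.card => m) := by
  have h := (measurePreserving_piEquivPiSubtypeProd (fun _ : Fin n => m)
    (fun i => i ∈ J)).lintegral_comp_emb (MeasurableEquiv.measurableEmbedding _)
    (fun q => G (ofFamily q.1, ofFamily q.2))
  refine h.trans ?_
  rw [lintegral_prod]
  · have hin : ∀ A, ∫⁻ z, G (A, ofFamily z) ∂Measure.pi (fun _ : {i // i ∉ J} => m) =
        ∫⁻ z, G (A, ofTuple z) ∂Measure.pi (fun _ : Fin (n - J.card) => m) := fun A =>
      lintegral_pi_ofFamily m (by simp) (fun C => G (A, C))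
    refine (lintegral_congr fun y => hin (ofFamily y)).trans ?_
    exact @lintegral_pi_ofFamily {i // i ∈ J} (Subtype.fintype _) m _ J.card (by simp)
      (fun A => ∫⁻ z, G (A, ofTuple z) ∂Measure.pi (fun _ : Fin (n - J.card) => m))
  · refine (hG.comp ?_).aemeasurable
    exact ((measurable_ofFamily _).comp measurable_fst).prodMk
      ((measurable_ofFamily _).comp measurable_snd)

-- The points lying in `D` form a single index set, so exactly one `J` contributes to the sum.
-- Repeated points do no harm, because `D` sees only the configuration.
open Classical in
lemma eq_sum_indicator {D : Config → Set Plane} {K : Set (Config × Config)}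
    (hK : ∀ A C, (A, C) ∈ K ↔
      A.pts ⊆ D (A.union C) ∧ Disjoint C.pts (D (A.union C)))
    (F : Config → ℝ≥0∞) {n : ℕ} (x : Fin n → Plane) :
    F (ofTuple x) = ∑ J : Finset (Fin n), K.indicator (fun q => F (q.1.union q.2))
      (ofFamily fun i : {i // i ∈ J} => x i, ofFamily fun i : {i // i ∉ J} => x i) := by
  have hun : ∀ J : Finset (Fin n), (ofFamily fun i : {i // i ∈ J} => x i).union
      (ofFamily fun i : {i // i ∉ J} => x i) = ofTuple x := by
    intro J
    ext p
    simp only [Config.union, ofFamily, ofTuple, mem_union, mem_range, Subtype.exists, exists_prop,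
      ← exists_or, ← or_and_right, Classical.em, true_and]
  have hmem : ∀ J : Finset (Fin n), (ofFamily fun i : {i // i ∈ J} => x i,
      ofFamily fun i : {i // i ∉ J} => x i) ∈ K ↔
        J = Finset.univ.filter fun i => x i ∈ D (ofTuple x) := by
    intro J
    rw [hK, hun]
    simp only [ofFamily, range_subset_iff, Subtype.forall, Set.disjoint_left, mem_range,
      Subtype.exists, exists_prop, forall_exists_index, and_imp, forall_apply_eq_imp_iff₂,
      Finset.ext_iff, Finset.mem_filter, Finset.mem_univ, true_and]
    exact ⟨fun h i => ⟨h.1 i, fun hi => by_contra fun hn => h.2 i hn hi⟩,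
      fun h => ⟨fun i hi => (h i).1 hi, fun i hi hD => hi ((h i).2 hD)⟩⟩
  simp only [indicator_apply, hmem, hun]
  simp

/-- A configuration may be split by a rule `D` that depends on the configuration itself; the
constraint `K` records that the rule, applied to the union, returns the given parts. The factorials
work out because choosing which `k` of `n` labels form the first part turns `1/n!` into
`1/(k!(n-k)!)`, and the sum over `n` becomes a Cauchy product. -/
lemma lintegral_lebesguePoisson_split (m : Measure Plane) [SigmaFinite m]
    {D : Config → Set Plane} {K : Set (Config × Config)} (hKm : MeasurableSet K)
    (hK : ∀ A C, (A, C) ∈ K ↔ A.pts ⊆ D (A.union C) ∧ Disjoint C.pts (D (A.union C)))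
    {F : Config → ℝ≥0∞} (hF : Measurable F) :
    ∫⁻ P, F P ∂lebesguePoisson m =
      ∫⁻ A, ∫⁻ C, K.indicator (fun q => F (q.1.union q.2)) (A, C)
        ∂lebesguePoisson m ∂lebesguePoisson m := by
  have hG : Measurable (K.indicator fun q : Config × Config => F (q.1.union q.2)) :=
    (hF.comp measurable_union).indicator hKm
  set G := K.indicator fun q : Config × Config => F (q.1.union q.2)
  let I : ℕ → ℕ → ℝ≥0∞ := fun k l => ∫⁻ y, ∫⁻ z, G (ofTuple y, ofTuple z)
    ∂Measure.pi (fun _ : Fin l => m) ∂Measure.pi (fun _ : Fin k => m)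
  have hleft : ∀ n : ℕ, (n ! : ℝ≥0∞)⁻¹ * ∫⁻ x, F (ofTuple x) ∂Measure.pi (fun _ : Fin n => m) =
      ∑ p ∈ Finset.HasAntidiagonal.antidiagonal n,
        (p.1 ! : ℝ≥0∞)⁻¹ * ((p.2 ! : ℝ≥0∞)⁻¹ * I p.1 p.2) := by
    intro n
    have h1 : ∫⁻ x, F (ofTuple x) ∂Measure.pi (fun _ : Fin n => m) =
        ∑ J : Finset (Fin n), I J.card (n - J.card) := by
      simp_rw [eq_sum_indicator hK F]
      rw [lintegral_finsetSum]
      · exact Finset.sum_congr rfl fun J _ => lintegral_pi_subset m J hG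
      · intro J _
        refine hG.comp (Measurable.prodMk ?_ ?_) <;>
        exact (measurable_ofFamily _).comp (measurable_pi_lambda _ fun i => measurable_pi_apply _)
    -- The summand depends on `J` only through its cardinality, so subsets are grouped by size.
    rw [h1, Finset.Nat.sum_antidiagonal_eq_sum_range_succ_mk, ← Finset.powerset_univ,
      Finset.sum_powerset_apply_card (fun k => I k (n - k)), Finset.card_univ, Fintype.card_fin,
      Finset.mul_sum]
    refine Finset.sum_congr rfl fun k hk => ?_
    have hkn : k ≤ n := Nat.lt_succ_iff.1 (Finset.mem_range.1 hk)
    rw [nsmul_eq_mul, ← mul_assoc, ← mul_assoc]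
    congr 1
    rw [← ENNReal.mul_inv (by simp) (by simp), ← Nat.choose_mul_factorial_mul_factorial hkn]
    push_cast
    have h0 : (n.choose k : ℝ≥0∞) ≠ 0 := by simpa using (Nat.choose_pos hkn).ne'
    rw [mul_assoc, ENNReal.mul_inv (.inl h0) (.inl (by simp)), mul_right_comm,
      ENNReal.inv_mul_cancel h0 (by simp), one_mul]
  rw [lintegral_lebesguePoisson m hF]
  simp_rw [hleft]
  have hright : ∫⁻ A, ∫⁻ C, G (A, C) ∂lebesguePoisson m ∂lebesguePoisson m =
      ∑' k : ℕ, ∑' l : ℕ, (k ! : ℝ≥0∞)⁻¹ * ((l ! : ℝ≥0∞)⁻¹ * I k l) := by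
    rw [lintegral_lebesguePoisson m hG.lintegral_prod_right']
    refine tsum_congr fun k => ?_
    rw [ENNReal.tsum_mul_left]
    congr 1
    have hin : ∀ y : Fin k → Plane, ∫⁻ C, G (ofTuple y, C) ∂lebesguePoisson m =
        ∑' l : ℕ, (l ! : ℝ≥0∞)⁻¹ * ∫⁻ z, G (ofTuple y, ofTuple z) ∂Measure.pi (fun _ => m) :=
      fun y => lintegral_lebesguePoisson m (hG.comp measurable_prodMk_left)
    have hm : ∀ l : ℕ, Measurable fun y : Fin k → Plane =>
        ∫⁻ z, G (ofTuple y, ofTuple z) ∂Measure.pi (fun _ : Fin l => m) := fun l =>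
      (hG.comp (((measurable_ofTuple k).comp measurable_fst).prodMk
        ((measurable_ofTuple l).comp measurable_snd))).lintegral_prod_right'
    simp_rw [hin]
    rw [lintegral_tsum fun l => ((hm l).const_mul _).aemeasurable]
    exact tsum_congr fun l => lintegral_const_mul _ (hm l)
  -- The double series over `(k, l)` is regrouped along `k + l = n`.
  rw [hright, ← ENNReal.tsum_prod, ← Finset.HasAntidiagonal.sigmaAntidiagonalEquivProd.tsum_eq,
    ENNReal.tsum_sigma']
  refine tsum_congr fun n => ?_
  rw [tsum_fintype, Finset.univ_eq_attach, ← Finset.sum_attach]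
  rfl

/-! ### Neighbourhoods of configurations -/

/-- The set of points at distance less than `2r` from some point of `B`. -/
def nbhd (r : ℝ) (B : Config) : Set Plane := {z | ∃ b ∈ B.pts, ‖z - b‖ < 2 * r}

/-- The configuration of the points of `P` that lie outside `D`. -/
def Config.remove (P : Config) (D : Set Plane) : Config := ⟨P.pts \ D, P.finite.sdiff⟩

lemma isOpen_nbhd (r : ℝ) (B : Config) : IsOpen (nbhd r B) := by
  have : nbhd r B = ⋃ b ∈ B.pts, {z | ‖z - b‖ < 2 * r} := by ext z; simp [nbhd]
  rw [this]
  exact isOpen_biUnion fun b _ => isOpen_lt (by fun_prop) (by fun_prop)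

lemma measurableSet_hit_nbhd (r : ℝ) {A : Set Plane} (hA : MeasurableSet A) :
    MeasurableSet {q : Config × Config | ∃ p ∈ q.2.pts, p ∈ A ∧ p ∈ nbhd r q.1} := by
  have hW : IsOpen {w : Plane × Plane | ‖w.1 - w.2‖ < 2 * r} :=
    isOpen_lt (by fun_prop) (by fun_prop)
  obtain ⟨U, V, hU, hV, hUV⟩ := exists_boxes hW
  have : {q : Config × Config | ∃ p ∈ q.2.pts, p ∈ A ∧ p ∈ nbhd r q.1} =
      ⋃ n, Prod.snd ⁻¹' {P : Config | ∃ p ∈ P.pts, p ∈ A ∩ U n} ∩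
        Prod.fst ⁻¹' {B : Config | ∃ b ∈ B.pts, b ∈ V n} := by
    ext ⟨B, P⟩
    simp only [nbhd, mem_ofPred_eq, mem_iUnion, mem_inter_iff, mem_preimage]
    constructor
    · rintro ⟨p, hp, hpA, b, hb, h⟩
      have hw : (p, b) ∈ {w : Plane × Plane | ‖w.1 - w.2‖ < 2 * r} := h
      rw [hUV] at hw
      obtain ⟨n, hn⟩ := mem_iUnion.1 hw
      exact ⟨n, ⟨p, hp, hpA, hn.1⟩, b, hb, hn.2⟩
    · rintro ⟨n, ⟨p, hp, hpA, hpU⟩, b, hb, hbV⟩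
      have hw : (p, b) ∈ {w : Plane × Plane | ‖w.1 - w.2‖ < 2 * r} := by
        rw [hUV]; exact mem_iUnion.2 ⟨n, hpU, hbV⟩
      exact ⟨p, hp, hpA, b, hb, hw⟩
  rw [this]
  exact MeasurableSet.iUnion fun n =>
    (measurable_snd (measurableSet_hit (hA.inter (hU n).measurableSet))).inter
      (measurable_fst (measurableSet_hit (hV n).measurableSet))

lemma measurable_remove_nbhd (r : ℝ) :
    Measurable fun q : Config × Config => q.2.remove (nbhd r q.1) := by
  refine measurable_of_hit fun A hA => ?_
  have hc : Countable (TopologicalSpace.countableBasis Plane) :=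
    (TopologicalSpace.countable_countableBasis Plane).to_subtype
  have hm : ∀ U : TopologicalSpace.countableBasis Plane, MeasurableSet (U : Set Plane) :=
    fun U => (TopologicalSpace.isOpen_of_mem_countableBasis U.2).measurableSet
  have : {q : Config × Config | ∃ p ∈ (q.2.remove (nbhd r q.1)).pts, p ∈ A} =
      ⋃ U : TopologicalSpace.countableBasis Plane,
        Prod.snd ⁻¹' {P : Config | ∃ p ∈ P.pts, p ∈ A ∩ (U : Set Plane)} ∩
        {q : Config × Config | ∃ p ∈ q.2.pts, p ∈ (U : Set Plane) ∧ p ∈ nbhd r q.1}ᶜ := by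
    ext ⟨B, P⟩
    simp only [Config.remove, mem_ofPred_eq, mem_iUnion, mem_inter_iff, mem_preimage,
      mem_compl_iff, mem_sdiff]
    constructor
    · rintro ⟨p, ⟨hp, hfar⟩, hpA⟩
      -- Finiteness lets a basic open set isolate `p`, so that "`p` is far from `B`" becomes "no
      -- point of `P` in this open set is near `B`", a countable family of events.
      have hopen : IsOpen (P.pts \ {p})ᶜ := (P.finite.sdiff).isClosed.isOpen_compl
      obtain ⟨U, hU, hpU, hsub⟩ :=
        (TopologicalSpace.isBasis_countableBasis Plane).exists_subset_of_mem_open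
          (a := p) (by simp) hopen
      refine ⟨⟨U, hU⟩, ⟨p, hp, hpA, hpU⟩, ?_⟩
      rintro ⟨x, hx, hxU, hxn⟩
      rcases eq_or_ne x p with rfl | hne
      · exact hfar hxn
      · exact hsub hxU ⟨hx, hne⟩
    · rintro ⟨U, ⟨p, hp, hpA, hpU⟩, hno⟩
      exact ⟨p, ⟨hp, fun hn => hno ⟨p, hp, hpU, hn⟩⟩, hpA⟩
  rw [this]
  exact MeasurableSet.iUnion fun U =>
    (measurable_snd (measurableSet_hit (hA.inter (hm U)))).inter
      (measurableSet_hit_nbhd r (hm U)).compl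

lemma measurableSet_badPoints_eq_pts (r : ℝ) :
    MeasurableSet {P : Config | badPoints r P = P.pts} := by
  have : {P : Config | badPoints r P = P.pts} =
      {P : Config | ∃ p ∈ P.pts \ badPoints r P, p ∈ univ}ᶜ := by
    ext P
    simp only [mem_ofPred_eq, mem_compl_iff, mem_univ, and_true, ← Set.Nonempty.eq_def,
      not_nonempty_iff_eq_empty, sdiff_eq_empty]
    exact ⟨fun h => h.ge, fun h => (badPoints_subset r P).antisymm h⟩
  rw [this]
  exact (measurableSet_hit_good r MeasurableSet.univ).compl

lemma measurableSet_pts_subset {D : Set Plane} (hD : MeasurableSet D) :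
    MeasurableSet {P : Config | P.pts ⊆ D} := by
  have : {P : Config | P.pts ⊆ D} = {P : Config | ∃ p ∈ P.pts, p ∈ Dᶜ}ᶜ := by
    ext P
    simp [subset_def]
  rw [this]
  exact (measurableSet_hit hD.compl).compl

/-! ### The decomposition of a configuration into bad and good points -/

/-- The pairs `(A, C)` such that `A` is the set of bad and `C` the set of good points of
`A ∪ C`. -/
def badGood (r : ℝ) : Set (Config × Config) :=
  {q | badPoints r q.1 = q.1.pts ∧ Disjoint q.2.pts (nbhd r q.1) ∧ badPoints r q.2 = ∅}

lemma measurableSet_badGood (r : ℝ) : MeasurableSet (badGood r) := by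
  refine (measurable_fst (measurableSet_badPoints_eq_pts r)).inter (MeasurableSet.inter ?_
    (measurable_snd (measurableSet_badPoints_eq_empty r)))
  have : {q : Config × Config | Disjoint q.2.pts (nbhd r q.1)} =
      {q : Config × Config | ∃ p ∈ q.2.pts, p ∈ univ ∧ p ∈ nbhd r q.1}ᶜ := by
    ext q
    simp only [Set.disjoint_left, mem_ofPred_eq, mem_compl_iff, mem_univ, true_and, not_exists,
      not_and]
  change MeasurableSet {q : Config × Config | Disjoint q.2.pts (nbhd r q.1)}
  rw [this]
  exact (measurableSet_hit_nbhd r MeasurableSet.univ).compl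

lemma badPoints_mono {r : ℝ} {P Q : Config} (h : P.pts ⊆ Q.pts) :
    badPoints r P ⊆ badPoints r Q := by
  intro x hx
  obtain ⟨hxP, y, hy, hxy, hn⟩ := mem_badPoints.1 hx
  exact mem_badPoints.2 ⟨h hxP, y, h hy, hxy, hn⟩

/-- This puts `badGood` in the form required by `lintegral_lebesguePoisson_split` with `D =
badPoints r`. Being bad is symmetric within a pair, so a partner of a bad point is never in `C`. -/
lemma mem_badGood_iff {r : ℝ} (A C : Config) :
    (A, C) ∈ badGood r ↔
      A.pts ⊆ badPoints r (A.union C) ∧ Disjoint C.pts (badPoints r (A.union C)) := by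
  constructor
  · rintro ⟨hA, hAC, hC⟩
    refine ⟨hA.ge.trans (badPoints_mono subset_union_left), Set.disjoint_left.2 fun p hp hbad => ?_⟩
    obtain ⟨-, y, hy | hy, hpy, hn⟩ := mem_badPoints.1 hbad
    · exact Set.disjoint_left.1 hAC hp ⟨y, hy, hn⟩
    · exact (hC ▸ mem_badPoints.2 ⟨hp, y, hy, hpy, hn⟩ : p ∈ (∅ : Set Plane))
  · rintro ⟨hA, hC⟩
    refine ⟨(badPoints_subset r A).antisymm fun a ha => ?_, Set.disjoint_left.2 fun p hp => ?_, ?_⟩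
    · obtain ⟨haU, y, hy, hay, hn⟩ := mem_badPoints.1 (hA ha)
      refine mem_badPoints.2 ⟨ha, y, hy.resolve_right fun hyC => ?_, hay, hn⟩
      exact Set.disjoint_left.1 hC hyC
        (mem_badPoints.2 ⟨hy, a, haU, hay.symm, by rwa [norm_sub_rev]⟩)
    · rintro ⟨a, ha, hn⟩
      refine Set.disjoint_left.1 hC hp (mem_badPoints.2 ⟨.inr hp, a, .inl ha, ?_, hn⟩)
      rintro rfl
      exact Set.disjoint_left.1 hC hp (hA ha)
    · exact eq_empty_of_forall_notMem fun p hp => Set.disjoint_left.1 hC (badPoints_subset r C hp)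
        (badPoints_mono subset_union_right hp)

lemma badPoints_union {r : ℝ} {A C : Config} (h : (A, C) ∈ badGood r) :
    badPoints r (A.union C) = A.pts := by
  obtain ⟨hA, hC⟩ := (mem_badGood_iff A C).1 h
  refine Subset.antisymm (fun p hp => ?_) hA
  exact (badPoints_subset r _ hp).resolve_right fun hpC => Set.disjoint_left.1 hC hpC hp

lemma update_union {r : ℝ} {A C : Config} (h : (A, C) ∈ badGood r) (Q : Config) :
    update r (A.union C) Q = C.union Q := by
  have hdis := ((mem_badGood_iff A C).1 h).2
  rw [badPoints_union h] at hdis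
  ext1
  simp only [update, badPoints_union h]
  simp only [Config.union, union_sdiff_left, hdis.sdiff_eq_left]

lemma resamplingSet_eq {r : ℝ} {P A : Config} (h : badPoints r P = A.pts) :
    resamplingSet r P = nbhd r A ∩ unitSquare := by
  ext z
  rw [mem_resamplingSet]
  refine and_congr_left fun _ => ?_
  simp only [nbhd, ← h, mem_badPoints, mem_ofPred_eq]
  grind

/-! ### Splitting the Lebesgue–Poisson measure -/

open Classical in
lemma lintegral_lebesguePoisson_restrict (m : Measure Plane) [SigmaFinite m] {D : Set Plane}
    (hD : MeasurableSet D) {F : Config → ℝ≥0∞} (hF : Measurable F) :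
    ∫⁻ P, F P ∂lebesguePoisson (m.restrict D) =
      ∫⁻ P, {P : Config | P.pts ⊆ D}.indicator F P ∂lebesguePoisson m := by
  rw [lintegral_lebesguePoisson _ hF,
    lintegral_lebesguePoisson _ (hF.indicator (measurableSet_pts_subset hD))]
  refine tsum_congr fun n => ?_
  congr 1
  rw [← Measure.restrict_pi_pi, ← lintegral_indicator (MeasurableSet.univ_pi fun _ => hD)]
  refine lintegral_congr fun x => ?_
  have : ofTuple x ∈ {P : Config | P.pts ⊆ D} ↔ x ∈ univ.pi fun _ => D := by
    simp [ofTuple, range_subset_iff]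
  simp only [indicator_apply, this]

-- The case of a fixed region: the Lebesgue–Poisson form of the independence of a Poisson process
-- inside and outside `D`.
open Classical in
lemma lintegral_lebesguePoisson_split_region (m : Measure Plane) [SigmaFinite m] {D : Set Plane}
    (hD : MeasurableSet D) {F : Config → ℝ≥0∞} (hF : Measurable F) :
    ∫⁻ P, F P ∂lebesguePoisson m =
      ∫⁻ C, {C : Config | Disjoint C.pts D}.indicator (fun C =>
        ∫⁻ Q, F (C.union Q) ∂lebesguePoisson (m.restrict D)) C ∂lebesguePoisson m := by
  rw [lintegral_lebesguePoisson_split m (D := fun _ => Dᶜ)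
    (K := {C : Config | C.pts ⊆ Dᶜ} ×ˢ {Q : Config | Q.pts ⊆ D}) ?_ ?_ hF]
  · refine lintegral_congr fun C => ?_
    simp only [indicator_apply, mem_ofPred_eq, ← subset_compl_iff_disjoint_right, mem_prod]
    by_cases h : C.pts ⊆ Dᶜ
    · have hFC : Measurable fun Q => F (C.union Q) :=
        hF.comp (measurable_union.comp measurable_prodMk_left)
      rw [if_pos h, lintegral_lebesguePoisson_restrict m hD hFC]
      simp [h, indicator_apply]
    · simp [h]
  · exact (measurableSet_pts_subset hD.compl).prod (measurableSet_pts_subset hD)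
  · intro A C
    simp [disjoint_compl_right_iff_subset]

/-! ### One execution of the loop body -/

/-- The probability that the resampled Poisson process is empty. -/
noncomputable def voidWeight (c : ℝ≥0) (r : ℝ) (B : Config) : ℝ≥0∞ :=
  ENNReal.ofReal (Real.exp (-(c * volume.real (resamplingSet r B))))

lemma measurable_voidWeight (c : ℝ≥0) (r : ℝ) : Measurable (voidWeight c r) := by
  have hv : Measurable fun P : Config => volume (resamplingSet r P) :=
    measurable_measure_prodMk_left (measurableSet_mem_resamplingSet r)
  have hv' : Measurable fun P : Config => volume.real (resamplingSet r P) := hv.ennreal_toReal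
  unfold voidWeight
  fun_prop

/-- The Lebesgue–Poisson measure of intensity `c` on the unit square. -/
noncomputable def squareMeasure (c : ℝ≥0) : Measure Config :=
  lebesguePoisson (c • (volume : Measure Plane).restrict unitSquare)

instance (c : ℝ≥0) : SFinite (squareMeasure c) := by
  unfold squareMeasure
  infer_instance

/-- The pairs `(B, P)` such that `B` consists of bad points and `P` has no bad pairs outside
the neighbourhood of `B`. -/
def goodOutside (r : ℝ) : Set (Config × Config) :=
  {q | badPoints r q.1 = q.1.pts ∧ badPoints r (q.2.remove (nbhd r q.1)) = ∅}

lemma measurableSet_goodOutside (r : ℝ) : MeasurableSet (goodOutside r) :=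
  (measurable_fst (measurableSet_badPoints_eq_pts r)).inter
    (measurable_remove_nbhd r (measurableSet_badPoints_eq_empty r))

/-- The density, after one execution of the loop body, of a point set that had density `g`. -/
noncomputable def nextDensity (c : ℝ≥0) (r : ℝ) (g : Config → ℝ≥0∞) (P : Config) : ℝ≥0∞ :=
  ∫⁻ B, (goodOutside r).indicator (fun q => g q.1 * voidWeight c r q.1) (B, P) ∂squareMeasure c

lemma measurable_nextDensity_integrand (c : ℝ≥0) (r : ℝ) {g : Config → ℝ≥0∞} (hg : Measurable g) :
    Measurable ((goodOutside r).indicator fun q => g q.1 * voidWeight c r q.1) :=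
  ((hg.comp measurable_fst).mul ((measurable_voidWeight c r).comp measurable_fst)).indicator
    (measurableSet_goodOutside r)

lemma measurable_nextDensity (c : ℝ≥0) (r : ℝ) {g : Config → ℝ≥0∞} (hg : Measurable g) :
    Measurable (nextDensity c r g) :=
  (measurable_nextDensity_integrand c r hg).lintegral_prod_left'

-- The invariant: both members of a bad pair of `P` outside the neighbourhood of `B` are bad points
-- of `P`, so the condition in `goodOutside` can be read off from `badPoints r P`.
open Classical in
lemma nextDensity_congr (c : ℝ≥0) (r : ℝ) (g : Config → ℝ≥0∞) {P P' : Config}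
    (h : badPoints r P = badPoints r P') : nextDensity c r g P = nextDensity c r g P' := by
  have key : ∀ {P P' : Config} (B : Config), badPoints r P = badPoints r P' →
      badPoints r (P.remove (nbhd r B)) = ∅ → badPoints r (P'.remove (nbhd r B)) = ∅ := by
    intro P P' B h hP
    refine eq_empty_of_forall_notMem fun x hx => ?_
    obtain ⟨⟨hxP, hxB⟩, y, ⟨hyP, hyB⟩, hxy, hn⟩ := mem_badPoints.1 hx
    have hx' : x ∈ badPoints r P := h ▸ mem_badPoints.2 ⟨hxP, y, hyP, hxy, hn⟩
    have hy' : y ∈ badPoints r P :=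
      h ▸ mem_badPoints.2 ⟨hyP, x, hxP, hxy.symm, by rwa [norm_sub_rev]⟩
    exact (hP ▸ mem_badPoints.2 ⟨⟨badPoints_subset r P hx', hxB⟩, y,
      ⟨badPoints_subset r P hy', hyB⟩, hxy, hn⟩ : x ∈ (∅ : Set Plane))
  refine lintegral_congr fun B => ?_
  have : (B, P) ∈ goodOutside r ↔ (B, P') ∈ goodOutside r :=
    and_congr_right fun _ => ⟨key B h, key B h.symm⟩
  simp only [indicator_apply, this]

lemma lintegral_loopBody (lam r : ℝ) (P : Config) {F : Config → ℝ≥0∞} (hF : Measurable F) :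
    ∫⁻ P', F P' ∂loopBody lam r P =
      ∫⁻ Q, F (update r P Q) ∂(poissonProcess (intensity lam r) (resamplingSet r P)) :=
  lintegral_map hF ((measurable_update r).comp measurable_prodMk_left)

lemma lintegral_loopBody_union {lam r : ℝ} {A C : Config} (h : (A, C) ∈ badGood r)
    {F : Config → ℝ≥0∞} (hF : Measurable F) :
    ∫⁻ P', F P' ∂loopBody lam r (A.union C) = voidWeight (intensity lam r) r A *
      ∫⁻ Q, F (C.union Q) ∂lebesguePoisson ((intensity lam r •
        (volume : Measure Plane).restrict unitSquare).restrict (nbhd r A)) := by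
  rw [lintegral_loopBody lam r _ hF, poissonProcess_eq_smul, lintegral_smul_measure,
    Measure.restrict_smul, Measure.restrict_restrict (isOpen_nbhd r A).measurableSet, voidWeight,
    resamplingSet_eq (badPoints_union h), resamplingSet_eq h.1]
  simp_rw [update_union h]
  rfl

/-- Both sides, tested against `F`, become integrals over the bad part `A`, the surviving good part
`C` and the fresh points `Q`. The hypothesis `hgb` replaces the density at `A ∪ C` by its value at
`A`, which can then be held fixed while `C ∪ Q` is merged into one configuration. -/
theorem bind_loopBody_withDensity {lam r : ℝ} {g : Config → ℝ≥0∞} (hg : Measurable g)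
    (hgb : ∀ P P', badPoints r P = badPoints r P' → g P = g P') :
    ((squareMeasure (intensity lam r)).withDensity g).bind (loopBody lam r) =
      (squareMeasure (intensity lam r)).withDensity (nextDensity (intensity lam r) r g) := by
  set c := intensity lam r with hc
  refine Measure.ext_of_lintegral _ fun F hF => ?_
  have hΦ : Measurable fun P => ∫⁻ P', F P' ∂loopBody lam r P := hF.lintegral_kernel
  rw [Measure.lintegral_bind (loopBody lam r).measurable.aemeasurable hF.aemeasurable,
    lintegral_withDensity_eq_lintegral_mul _ hg hΦ,
    lintegral_withDensity_eq_lintegral_mul _ (measurable_nextDensity c r hg) hF]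
  -- Tonelli puts the old bad part outside, to match the splitting of the left side.
  have hR : ∫⁻ P, (nextDensity c r g * F) P ∂squareMeasure c =
      ∫⁻ B, ∫⁻ P, (goodOutside r).indicator (fun q => g q.1 * voidWeight c r q.1) (B, P) * F P
        ∂squareMeasure c ∂squareMeasure c := by
    rw [lintegral_lintegral_swap]
    · refine lintegral_congr fun P => ?_
      exact (lintegral_mul_const (F P)
        ((measurable_nextDensity_integrand c r hg).comp measurable_prodMk_right)).symm
    · exact ((measurable_nextDensity_integrand c r hg).mul
        (hF.comp measurable_snd)).aemeasurable
  rw [hR, squareMeasure, lintegral_lebesguePoisson_split _ (measurableSet_badGood r)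
    mem_badGood_iff (hg.mul hΦ)]
  refine lintegral_congr fun A => ?_
  by_cases hA : badPoints r A = A.pts
  swap
  · simp [badGood, goodOutside, hA]
  have hFA : Measurable fun P => (goodOutside r).indicator
      (fun q => g q.1 * voidWeight c r q.1) (A, P) * F P :=
    ((measurable_nextDensity_integrand c r hg).comp measurable_prodMk_left).mul hF
  -- The new configuration is cut along the neighbourhood of `A`: its outer part plays the role of
  -- `C`, its inner part that of `Q`.
  rw [lintegral_lebesguePoisson_split_region _ (isOpen_nbhd r A).measurableSet hFA]
  refine lintegral_congr fun C => ?_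
  by_cases hC : Disjoint C.pts (nbhd r A)
  swap
  · simp [badGood, hC]
  rw [indicator_of_mem (s := {C : Config | Disjoint C.pts (nbhd r A)}) hC]
  have hU : Measurable C.union := measurable_union.comp measurable_prodMk_left
  have hFC : Measurable fun Q => F (C.union Q) := hF.comp hU
  have hFAC : Measurable fun Q => (goodOutside r).indicator
      (fun q => g q.1 * voidWeight c r q.1) (A, C.union Q) * F (C.union Q) := hFA.comp hU
  rw [lintegral_lebesguePoisson_restrict _ (isOpen_nbhd r A).measurableSet hFAC]
  have hrem : ∀ Q ∈ {Q : Config | Q.pts ⊆ nbhd r A}, (C.union Q).remove (nbhd r A) = C := by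
    intro Q hQ
    ext1
    simp only [Config.remove, Config.union, union_sdiff_distrib, hC.sdiff_eq_left,
      sdiff_eq_empty.2 hQ, union_empty]
  -- Removing the neighbourhood of `A` from `C ∪ Q` gives back `C`, so `goodOutside` holds exactly
  -- when `C` is hard; otherwise both sides vanish.
  by_cases hCg : badPoints r C = ∅
  · have hAC : (A, C) ∈ badGood r := ⟨hA, hC, hCg⟩
    have hgA : g (A.union C) = g A := hgb _ _ ((badPoints_union hAC).trans hA.symm)
    rw [indicator_of_mem hAC, Pi.mul_apply, hgA, lintegral_loopBody_union hAC hF, ← mul_assoc,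
      lintegral_lebesguePoisson_restrict _ (isOpen_nbhd r A).measurableSet
        hFC, ← lintegral_const_mul]
    · refine lintegral_congr fun Q => ?_
      by_cases hQ : Q ∈ {Q : Config | Q.pts ⊆ nbhd r A}
      · rw [indicator_of_mem hQ, indicator_of_mem hQ, indicator_of_mem]
        exact ⟨hA, by rw [hrem Q hQ]; exact hCg⟩
      · rw [indicator_of_notMem hQ, indicator_of_notMem hQ, mul_zero]
    · exact hFC.indicator (measurableSet_pts_subset (isOpen_nbhd r A).measurableSet)
  · rw [indicator_of_notMem fun h => hCg h.2.2, eq_comm, lintegral_eq_zero_of_ae_eq_zero]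
    refine .of_forall fun Q => ?_
    by_cases hQ : Q ∈ {Q : Config | Q.pts ⊆ nbhd r A}
    · rw [indicator_of_mem hQ, indicator_of_notMem, zero_mul]
      · rfl
      · intro h
        exact hCg (by rw [← hrem Q hQ]; exact h.2)
    · exact indicator_of_notMem hQ _

/-! ### Trajectories of homogeneous Markov chains -/

section Chain

variable {X : Type*} [MeasurableSpace X]

/-- The law of the Markov chain with initial law `μ` and transition kernel `κ`. -/
noncomputable def chainLaw (μ : Measure X) (κ : Kernel X X) [IsMarkovKernel κ] :
    Measure (ℕ → X) :=
  Kernel.trajMeasure (X := fun _ => X) μ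
    fun t => κ.comap (fun h => h ⟨t, Finset.mem_Iic.2 le_rfl⟩) (measurable_pi_apply _)

variable (μ : Measure X) (κ : Kernel X X) [IsMarkovKernel κ]

instance [IsProbabilityMeasure μ] : IsProbabilityMeasure (chainLaw μ κ) := by
  unfold chainLaw
  infer_instance

lemma chainLaw_map_zero : (chainLaw μ κ).map (fun x => x 0) = μ := by
  have h : (chainLaw μ κ).map (Preorder.frestrictLe 0) =
      μ.map (MeasurableEquiv.piUnique fun _ : Finset.Iic 0 => X).symm := by
    rw [chainLaw, Kernel.trajMeasure, Measure.map_comp _ _ (by fun_prop),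
      Kernel.traj_map_frestrictLe, Kernel.partialTraj_self, Measure.id_comp]
  have h2 : (fun x : ℕ → X => x 0) =
      (fun h : (Finset.Iic 0 → X) => h ⟨0, Finset.mem_Iic.2 le_rfl⟩) ∘
        (Preorder.frestrictLe (π := fun _ => X) 0) := rfl
  have he : Measurable fun h : (Finset.Iic 0 → X) => h ⟨0, Finset.mem_Iic.2 le_rfl⟩ :=
    measurable_pi_apply _
  rw [h2, ← Measure.map_map he (Preorder.measurable_frestrictLe 0), h,
    Measure.map_map he (MeasurableEquiv.measurable _)]
  exact Measure.map_id

variable [IsProbabilityMeasure μ]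

/-- The transition kernel reads only the last coordinate of the history, so the joint law of history
and next state projects to the law of two consecutive states. -/
lemma chainLaw_step (t : ℕ) {A B : Set X} (hA : MeasurableSet A) (hB : MeasurableSet B) :
    chainLaw μ κ {x | x t ∈ A ∧ x (t + 1) ∈ B} =
      ∫⁻ a in A, κ a B ∂(chainLaw μ κ).map (fun x => x t) := by
  let e : (Finset.Iic t → X) → X := fun h => h ⟨t, Finset.mem_Iic.2 le_rfl⟩
  have he : Measurable e := measurable_pi_apply _
  have h := Kernel.map_frestrictLe_trajMeasure_compProd_eq_map_trajMeasure
    (X := fun _ => X) (μ₀ := μ) (a := t)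
    (κ := fun t => κ.comap (fun h : (Finset.Iic t → X) => h ⟨t, Finset.mem_Iic.2 le_rfl⟩)
      (measurable_pi_apply _))
  have h' := congrArg (fun ν => ν ((e ⁻¹' A) ×ˢ B)) h
  rw [Measure.compProd_apply_prod (he hA) hB,
    Measure.map_apply (by fun_prop) ((he hA).prod hB)] at h'
  have hm : (chainLaw μ κ).map (fun x => x t) =
      ((chainLaw μ κ).map (Preorder.frestrictLe t)).map e :=
    (Measure.map_map (g := e) (f := Preorder.frestrictLe (π := fun _ => X) t) he
      (Preorder.measurable_frestrictLe t)).symm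
  rw [hm, setLIntegral_map hA (κ.measurable_coe hB) he]
  exact h'.symm

lemma chainLaw_map_succ (t : ℕ) :
    (chainLaw μ κ).map (fun x => x (t + 1)) = ((chainLaw μ κ).map (fun x => x t)).bind κ := by
  ext B hB
  rw [Measure.bind_apply hB κ.aemeasurable, Measure.map_apply (measurable_pi_apply _) hB,
    ← setLIntegral_univ, ← chainLaw_step μ κ t MeasurableSet.univ hB]
  simp only [mem_univ, true_and]
  rfl

lemma chainLaw_absorbing {Z : Set X} (hZ : MeasurableSet Z) (hκ : ∀ a ∈ Z, κ a Zᶜ = 0) :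
    ∀ᵐ x ∂chainLaw μ κ, ∀ s t, s ≤ t → x s ∈ Z → x t ∈ Z := by
  have hstep : ∀ᵐ x ∂chainLaw μ κ, ∀ t, x t ∈ Z → x (t + 1) ∈ Z := by
    rw [ae_all_iff]
    intro t
    have h0 : chainLaw μ κ {x | x t ∈ Z ∧ x (t + 1) ∈ Zᶜ} = 0 := by
      rw [chainLaw_step μ κ t hZ hZ.compl, setLIntegral_congr_fun hZ hκ, lintegral_zero]
    rw [ae_iff]
    simpa only [Classical.not_imp, mem_compl_iff] using h0
  filter_upwards [hstep] with x hx s t hst hs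
  induction t, hst using Nat.le_induction with
  | base => exact hs
  | succ t _ ih => exact hx t ih

end Chain

/-! ### Runs of the algorithm -/

/-- The configurations without bad points. -/
def hardConfigs (r : ℝ) : Set Config := {P | badPoints r P = ∅}

lemma measurableSet_hardConfigs (r : ℝ) : MeasurableSet (hardConfigs r) :=
  measurableSet_badPoints_eq_empty r

lemma isProbabilityMeasure_poissonProcess_unitSquare (c : ℝ≥0) :
    IsProbabilityMeasure (poissonProcess c unitSquare) :=
  isProbabilityMeasure_poissonProcess c volume_unitSquare_ne_top

lemma runLaw_eq_chainLaw (lam r : ℝ) :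
    runLaw lam r = chainLaw (poissonProcess (intensity lam r) unitSquare) (loopBody lam r) := rfl

/-- Without bad points the resampling region is empty, so almost surely nothing is added or removed.
Allowing an arbitrary `E` expresses that hard configurations are fixed, not merely that they remain
hard. -/
lemma loopBody_absorbing (lam r : ℝ) {E : Set Config} (hE : MeasurableSet E) :
    ∀ P ∈ hardConfigs r ∩ E, loopBody lam r P (hardConfigs r ∩ E)ᶜ = 0 := by
  rintro P ⟨hP, hPE⟩
  have hP' : badPoints r P = ∅ := hP
  have hS : resamplingSet r P = ∅ := by simp [resamplingSet, hP']
  have hvoid : poissonProcess (intensity lam r) ∅ {Q | ¬ ∃ p ∈ Q.pts, p ∈ univ} = 1 := by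
    rw [poissonProcess_void _ (by simp) MeasurableSet.univ]
    simp
  have hprob := isProbabilityMeasure_poissonProcess (intensity lam r) (S := ∅) (by simp)
  have hm := (measurableSet_hit MeasurableSet.univ).compl
  have h0 := (prob_compl_eq_zero_iff (μ := poissonProcess (intensity lam r) ∅) hm).2 hvoid
  change (poissonProcess (intensity lam r) (resamplingSet r P)).map (update r P) _ = 0
  have hu : Measurable (update r P) := (measurable_update r).comp measurable_prodMk_left
  rw [Measure.map_apply hu ((measurableSet_hardConfigs r).inter hE).compl, hS]
  refine measure_mono_null (fun Q hQ => ?_) h0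
  intro hQ'
  apply hQ
  have : update r P Q = P := by
    ext1
    have hQe : Q.pts = ∅ := by
      refine eq_empty_of_forall_notMem fun p hp => hQ' ⟨p, hp, mem_univ p⟩
    simp [update, hP', hQe]
  rw [this]
  exact ⟨hP, hPE⟩

/-! ### The law of the point set at a fixed time. -/

/-- The density, with respect to the Lebesgue–Poisson measure on the unit square, of the point
set after `t` executions of the loop body. -/
noncomputable def density (lam r : ℝ) : ℕ → Config → ℝ≥0∞
  | 0 => fun _ => ENNReal.ofReal (Real.exp (-(intensity lam r * volume.real unitSquare)))
  | t + 1 => nextDensity (intensity lam r) r (density lam r t)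

lemma measurable_density (lam r : ℝ) (t : ℕ) : Measurable (density lam r t) := by
  induction t with
  | zero => exact measurable_const
  | succ t ih => exact measurable_nextDensity _ r ih

lemma density_congr (lam r : ℝ) (t : ℕ) {P P' : Config} (h : badPoints r P = badPoints r P') :
    density lam r t P = density lam r t P' := by
  cases t with
  | zero => rfl
  | succ t => exact nextDensity_congr _ r _ h

lemma runLaw_map_eq_withDensity (lam r : ℝ) (t : ℕ) :
    (runLaw lam r).map (fun P => P t) =
      (squareMeasure (intensity lam r)).withDensity (density lam r t) := by
  have := isProbabilityMeasure_poissonProcess_unitSquare (intensity lam r)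
  rw [runLaw_eq_chainLaw]
  induction t with
  | zero => rw [chainLaw_map_zero, density, withDensity_const, poissonProcess_eq_smul]; rfl
  | succ t ih =>
    rw [chainLaw_map_succ, ih, bind_loopBody_withDensity (measurable_density lam r t)
      fun P P' h => density_congr lam r t h]
    rfl

/-- The configuration without points. -/
def emptyConfig : Config := ⟨∅, finite_empty⟩

lemma badPoints_emptyConfig (r : ℝ) : badPoints r emptyConfig = ∅ :=
  subset_eq_empty (badPoints_subset r _) rfl

lemma measurable_pointSet (t : ℕ) : Measurable fun P : ℕ → Config => P t :=
  measurable_pi_apply t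

/-- Hard configurations share their bad set with the empty configuration, so the density is constant
on them. -/
lemma runLaw_hardConfigs_inter (lam r : ℝ) (t : ℕ) {E : Set Config} (hE : MeasurableSet E) :
    runLaw lam r {P | P t ∈ hardConfigs r ∩ E} =
      density lam r t emptyConfig * squareMeasure (intensity lam r) (hardConfigs r ∩ E) := by
  have hm := (measurableSet_hardConfigs r).inter hE
  have h : runLaw lam r {P | P t ∈ hardConfigs r ∩ E} =
      (runLaw lam r).map (fun P => P t) (hardConfigs r ∩ E) :=
    (Measure.map_apply (measurable_pointSet t) hm).symm
  rw [h, runLaw_map_eq_withDensity, withDensity_apply _ hm, ← setLIntegral_const]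
  refine setLIntegral_congr_fun hm fun P hP => density_congr lam r t ?_
  rw [badPoints_emptyConfig]
  exact hP.1

/-! ### The halting time and the output. -/

lemma measurable_output (r : ℝ) : Measurable (output r) := by
  have hH : ∀ t, MeasurableSet {P : ℕ → Config | badPoints r (P t) = ∅} := fun t =>
    measurable_pointSet t (measurableSet_hardConfigs r)
  have hT : ∀ n, MeasurableSet {P : ℕ → Config | sInf {t | badPoints r (P t) = ∅} = n} := by
    intro n
    -- The second piece accounts for runs that never halt, for which `sInf ∅ = 0`.
    have : {P : ℕ → Config | sInf {t | badPoints r (P t) = ∅} = n} =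
        ({P | badPoints r (P n) = ∅} ∩ ⋂ m, ⋂ (_ : m < n), {P | badPoints r (P m) = ∅}ᶜ) ∪
          ({_P | n = 0} ∩ ⋂ m, {P | badPoints r (P m) = ∅}ᶜ) := by
      ext P
      simp only [mem_ofPred_eq, mem_union, mem_inter_iff, mem_iInter, mem_compl_iff]
      constructor
      · rintro rfl
        rcases eq_empty_or_nonempty {t | badPoints r (P t) = ∅} with h | h
        · refine .inr ⟨by simp [h], fun m hm => ?_⟩
          exact (h ▸ hm : m ∈ (∅ : Set ℕ))
        · exact .inl ⟨Nat.sInf_mem h, fun m hm => Nat.notMem_of_lt_sInf hm⟩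
      · rintro (⟨hn, hlt⟩ | ⟨rfl, h⟩)
        · refine (Nat.sInf_le hn).antisymm (not_lt.1 fun hs => hlt _ hs ?_)
          exact Nat.sInf_mem (s := {t | badPoints r (P t) = ∅}) ⟨n, hn⟩
        · rw [Nat.sInf_eq_zero]
          exact .inr (eq_empty_of_forall_notMem h)
    rw [this]
    exact ((hH n).inter (.iInter fun m => .iInter fun _ => (hH m).compl)).union
      ((MeasurableSet.const _).inter (.iInter fun m => (hH m).compl))
  intro E hE
  have : output r ⁻¹' E =
      ⋃ n, {P : ℕ → Config | sInf {t | badPoints r (P t) = ∅} = n} ∩ {P | P n ∈ E} := by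
    ext P
    simp [output]
  rw [this]
  exact .iUnion fun n => (hT n).inter (measurable_pointSet n hE)

/-- Absorption replaces the random halting time by deterministic times, and continuity from below
gives the supremum. Absorption is needed for `E` and for its complement: a run that is hard and in
`E` at some time cannot have first become hard outside `E`. -/
lemma runLaw_halts_inter_output (lam r : ℝ) {E : Set Config} (hE : MeasurableSet E) :
    runLaw lam r (halts r ∩ output r ⁻¹' E) =
      (⨆ t, density lam r t emptyConfig) *
        squareMeasure (intensity lam r) (hardConfigs r ∩ E) := by
  have := isProbabilityMeasure_poissonProcess_unitSquare (intensity lam r)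
  have hin := chainLaw_absorbing (poissonProcess (intensity lam r) unitSquare) (loopBody lam r)
    ((measurableSet_hardConfigs r).inter hE) (loopBody_absorbing lam r hE)
  have hout := chainLaw_absorbing (poissonProcess (intensity lam r) unitSquare) (loopBody lam r)
    ((measurableSet_hardConfigs r).inter hE.compl) (loopBody_absorbing lam r hE.compl)
  rw [← runLaw_eq_chainLaw] at hin hout
  -- Intersecting with the almost sure event `G` makes the union over `t` increasing pointwise, not
  -- just up to null sets.
  set G : Set (ℕ → Config) :=
    {P | ∀ s t, s ≤ t → P s ∈ hardConfigs r ∩ E → P t ∈ hardConfigs r ∩ E}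
  have hA : (halts r ∩ output r ⁻¹' E : Set (ℕ → Config)) =ᵐ[runLaw lam r]
      ⋃ t, {P | P t ∈ hardConfigs r ∩ E} ∩ G := by
    rw [Filter.eventuallyEq_set]
    filter_upwards [hin, hout] with P hPin hPout
    simp only [mem_iUnion]
    constructor
    · rintro ⟨hh, ho⟩
      exact ⟨_, ⟨Nat.sInf_mem (s := {t | badPoints r (P t) = ∅}) hh, ho⟩, hPin⟩
    · rintro ⟨t, ht, -⟩
      refine ⟨⟨t, ht.1⟩, by_contra fun ho => ?_⟩
      exact (hPout _ t (Nat.sInf_le ht.1)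
        ⟨Nat.sInf_mem (s := {t | badPoints r (P t) = ∅}) ⟨t, ht.1⟩, ho⟩).2 ht.2
  have hmono : Monotone fun t => {P : ℕ → Config | P t ∈ hardConfigs r ∩ E} ∩ G :=
    fun s t hst P hP => ⟨hP.2 s t hst hP.1, hP.2⟩
  rw [measure_congr hA, hmono.measure_iUnion, ENNReal.iSup_mul]
  refine iSup_congr fun t => ?_
  rw [← runLaw_hardConfigs_inter lam r t hE]
  exact measure_inter_conull hin

/-- The empty configuration is hard and has positive probability. -/
lemma poissonProcess_hardConfigs_ne_zero (c : ℝ≥0) (r : ℝ) :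
    poissonProcess c unitSquare (hardConfigs r) ≠ 0 := by
  have hvoid := poissonProcess_void c volume_unitSquare_ne_top MeasurableSet.univ
  refine fun h0 => (?_ : poissonProcess c unitSquare {P | ¬ ∃ p ∈ P.pts, p ∈ univ} ≠ 0)
    (measure_mono_null (fun P hP => ?_) h0)
  · rw [hvoid]
    simpa using Real.exp_pos _
  · exact eq_empty_of_forall_notMem fun p hp => hP ⟨p, badPoints_subset r P hp, mem_univ p⟩

lemma exists_runLaw_halts_inter_output_eq (lam r : ℝ) :
    ∃ a : ℝ≥0∞, a ≠ 0 ∧ ∀ E, MeasurableSet E → runLaw lam r (halts r ∩ output r ⁻¹' E) =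
      a * poissonProcess (intensity lam r) unitSquare (hardConfigs r ∩ E) := by
  set w := ENNReal.ofReal (Real.exp (-(intensity lam r * volume.real unitSquare))) with hw
  have hw0 : w ≠ 0 := by simpa [hw] using Real.exp_pos _
  have hwt : w ≠ ∞ := ENNReal.ofReal_ne_top
  -- The factor `w⁻¹` converts Lebesgue–Poisson mass to Poisson mass. The supremum is nonzero
  -- because its term at `t = 0` is `w`.
  refine ⟨(⨆ t, density lam r t emptyConfig) * w⁻¹, ?_, fun E hE => ?_⟩
  · refine mul_ne_zero (fun h => hw0 ?_) (ENNReal.inv_ne_zero.2 hwt)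
    exact ENNReal.iSup_eq_zero.1 h 0
  · rw [runLaw_halts_inter_output lam r hE, poissonProcess_eq_smul, Measure.smul_apply, smul_eq_mul,
      mul_assoc, ENNReal.inv_mul_cancel_left hw0 hwt]
    rfl

lemma hardDisks_eq_cond (lam r : ℝ) :
    hardDisks lam r = (poissonProcess (intensity lam r) unitSquare)[|hardConfigs r] := by
  have : {P : Config | ∀ x ∈ P.pts, ∀ y ∈ P.pts, x ≠ y → 2 * r ≤ ‖x - y‖} = hardConfigs r := by
    ext P
    simp only [hardConfigs, mem_ofPred_eq, eq_empty_iff_forall_notMem, mem_badPoints]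
    push Not
    rfl
  rw [hardDisks, this]

lemma measurableSet_halts (r : ℝ) : MeasurableSet (halts r) := by
  have : halts r = ⋃ t, {P : ℕ → Config | P t ∈ hardConfigs r} := by
    ext P; simp [halts, hardConfigs]
  rw [this]
  exact .iUnion fun t => measurable_pointSet t (measurableSet_hardConfigs r)

end HardDisks

open HardDisks in
theorem theorem1 (lam r : ℝ) (hlam : 0 < lam) (hr : 0 < r) :
    HardDisks.runLaw lam r (HardDisks.halts r) ≠ 0 ∧
    IsProbabilityMeasure (HardDisks.hardDisks lam r) ∧
    ((HardDisks.runLaw lam r)[|HardDisks.halts r]).map (HardDisks.output r) =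
      HardDisks.hardDisks lam r := by
  have := isProbabilityMeasure_poissonProcess_unitSquare (intensity lam r)
  have hrun : IsProbabilityMeasure (runLaw lam r) := by
    rw [runLaw_eq_chainLaw]; infer_instance
  obtain ⟨a, ha, h⟩ := exists_runLaw_halts_inter_output_eq lam r
  have hH := poissonProcess_hardConfigs_ne_zero (intensity lam r) r
  have hhalts : runLaw lam r (halts r) =
      a * poissonProcess (intensity lam r) unitSquare (hardConfigs r) := by
    simpa using h univ MeasurableSet.univ
  -- Were `a` infinite, the halting probability would be infinite. Finiteness is needed to cancel
  -- `a` in the conditional law.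
  have hat : a ≠ ∞ := by
    rintro rfl
    rw [ENNReal.top_mul hH] at hhalts
    exact measure_ne_top _ _ hhalts
  refine ⟨by rw [hhalts]; exact mul_ne_zero ha hH, ?_, ?_⟩
  · rw [hardDisks_eq_cond]
    exact cond_isProbabilityMeasure hH
  · ext E hE
    rw [Measure.map_apply (measurable_output r) hE, cond_apply (measurableSet_halts r), h E hE,
      hhalts, hardDisks_eq_cond, cond_apply (measurableSet_hardConfigs r),
      ENNReal.mul_inv (.inl ha) (.inl hat), mul_mul_mul_comm, ENNReal.inv_mul_cancel ha hat,
      one_mul]
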